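/- Let $G$ be a non-trivial finite group, regarded as a discrete topological space, and let $P$ be a finite free $G$-poset, i.e. a finite partially ordered set with an order-preserving action of $G$ such that $gp=p$ implies $g=e$. Let $\Delta(P)$ be its order complex (the simplices are the non-empty chains of $P$), with the induced $G$-action, let $\mathrm{sd}^r$ denote the $r$-fold barycentric subdivision ($\mathrm{sd}^0(\mathcal K)=\mathcal K$), and let $\mathcal F(\mathcal K)$ be the face poset of a $G$-simplicial complex $\mathcal K$, i.e. its non-empty simplices ordered by inclusion, with the induced $G$-action. For a $G$-space $X$, the mapping index $\mathrm{ind}\,X$ is the smallest $k\ge 0$ such that there is a continuous $G$-equivariant map $X\to E_kG$, where $E_kG=G^{*(k+1)}$ is the $(k+1)$-fold join of $G$ with the diagonal action. For a $G$-poset $Q$, the cross-index $\mathrm{xind}\,Q$ is the smallest $n\ge 0$ such that there is an order-preserving $G$-equivariant map $Q\to Q_nG$, where $Q_nG=G\times\{0,\dots,n\}$ has the action $g\cdot(h,i)=(gh,i)$ and the order in which $(g,i)\prec(h,j)$ if and only if $i<j$. Both indices are $\infty$ if there is no such integer. Then $\mathrm{ind}\,\Delta(P)$ (the mapping index of the geometric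 realization of $\Delta(P)$) is finite, and there is an $r_0\ge 0$ such that for all $r\ge r_0$ $$\mathrm{xind}\,\mathcal F\bigl(\mathrm{sd}^r(\Delta(P))\bigr)=\mathrm{ind}\,\Delta(P).$$ -/

import Mathlib

universe u v

/-! ### The posets `Q_n G` and the cross-index -/

/-- The ground set `G × {0, …, n}` of the `G`-poset `Q_n G`. -/
@[ext]
structure QPoset (G : Type u) (n : ℕ) where
  elt : G
  level : Fin (n + 1)

/-- `(g, i) < (h, j)` if and only if `i < j`; two different elements of the same level are
incomparable. -/
instance QPoset.instPartialOrder (G : Type u) (n : ℕ) : PartialOrder (QPoset G n) where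
  le x y := x = y ∨ x.level < y.level
  le_refl _ := Or.inl rfl
  le_trans _ _ _ hxy hyz := by
    rcases hxy with rfl | hxy
    · exact hyz
    · rcases hyz with rfl | hyz
      · exact Or.inr hxy
      · exact Or.inr (hxy.trans hyz)
  le_antisymm _ _ hxy hyx := by
    rcases hxy with h | hxy
    · exact h
    · rcases hyx with h | hyx
      · exact h.symm
      · exact absurd (hxy.trans hyx) (lt_irrefl _)

instance QPoset.instMulAction (G : Type u) [Group G] (n : ℕ) : MulAction G (QPoset G n) where
  smul g x := ⟨g * x.elt, x.level⟩
  one_smul _ := QPoset.ext (one_mul _) rfl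
  mul_smul _ _ _ := QPoset.ext (mul_assoc _ _ _) rfl

/-- The cross-index of a poset `P` with an action of `G`: the smallest `n` such that there is an
order-preserving `G`-equivariant map from `P` to `Q_n G` (and `⊤` if there is no such `n`). -/
noncomputable def crossIndex (G : Type u) [Group G] (P : Type v) [PartialOrder P] [MulAction G P] :
    ℕ∞ :=
  ⨅ (n : ℕ) (_ : ∃ f : P → QPoset G n, Monotone f ∧ ∀ (g : G) (p : P), f (g • p) = g • f p),
    (n : ℕ∞)

/-! ### The spaces `E_k G` and the mapping index -/

/-- The relation that defines the `(k+1)`-fold join of `Y`: the formal convex combinations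
`t₀ y₀ + ⋯ + t_k y_k` and `t₀' y₀' + ⋯ + t_k' y_k'` are identified when `t = t'` and `yᵢ = yᵢ'`
for all `i` with `tᵢ ≠ 0`. -/
def joinSetoid (Y : Type u) (k : ℕ) :
    Setoid ((Fin (k + 1) → Y) × stdSimplex ℝ (Fin (k + 1))) where
  r a b := a.2 = b.2 ∧ ∀ i, (a.2 : Fin (k + 1) → ℝ) i ≠ 0 → a.1 i = b.1 i
  iseqv :=
    { refl := fun _ => ⟨rfl, fun _ _ => rfl⟩
      symm := fun h => ⟨h.1.symm, fun i hi => (h.2 i (by rw [h.1]; exact hi)).symm⟩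
      trans := fun h h' => ⟨h.1.trans h'.1, fun i hi =>
        (h.2 i hi).trans (h'.2 i (by rw [← h.1]; exact hi))⟩ }

/-- `E_k G`, the `(k+1)`-fold join `G * ⋯ * G` of the topological space `G`. -/
def EG (G : Type u) (k : ℕ) : Type u := Quotient (joinSetoid G k)

/-- The join carries the quotient topology. -/
instance EG.instTopologicalSpace (G : Type u) [TopologicalSpace G] (k : ℕ) :
    TopologicalSpace (EG G k) :=
  inferInstanceAs (TopologicalSpace (Quotient (joinSetoid G k)))

/-- `G` acts diagonally: `g • (t₀ h₀ + ⋯ + t_k h_k) = t₀ (g h₀) + ⋯ + t_k (g h_k)`. -/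
instance EG.instMulAction (G : Type u) [Group G] (k : ℕ) : MulAction G (EG G k) where
  smul g := Quotient.map (fun a => (fun i => g * a.1 i, a.2))
    (fun _ _ h => ⟨h.1, fun i hi => congrArg (g * ·) (h.2 i hi)⟩)
  one_smul x := by
    induction x using Quotient.inductionOn with
    | h a => exact congrArg (Quotient.mk _) (Prod.ext (funext fun i => one_mul _) rfl)
  mul_smul g h x := by
    induction x using Quotient.inductionOn with
    | h a => exact congrArg (Quotient.mk _) (Prod.ext (funext fun i => mul_assoc _ _ _) rfl)

/-- The mapping index of a topological space `X` with an action of `G`: the smallest `k` such that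
there is a continuous `G`-equivariant map from `X` to `E_k G` (and `⊤` if there is no such `k`). -/
noncomputable def mappingIndex (G : Type u) [Group G] [TopologicalSpace G] (X : Type v)
    [TopologicalSpace X] [MulAction G X] : ℕ∞ :=
  ⨅ (k : ℕ) (_ : ∃ f : X → EG G k, Continuous f ∧ ∀ (g : G) (x : X), f (g • x) = g • f x),
    (k : ℕ∞)

/-! ### `G`-simplicial complexes -/

/-- A `G`-simplicial complex: an abstract simplicial complex with an action of `G` on its vertices
that maps simplices to simplices. -/
structure GComplex (G : Type u) [Group G] where
  V : Type v
  [action : MulAction G V]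
  complex : AbstractSimplicialComplex V
  smul_mem : ∀ (g : G) (s : Finset V), s ∈ complex.faces →
    s.map (MulAction.toPerm g).toEmbedding ∈ complex.faces

attribute [instance] GComplex.action

namespace GComplex

variable {G : Type u} [Group G]

/-- The set of all (non-empty) simplices of `K`. -/
def FacePoset (K : GComplex.{u, v} G) : Type v := {s : Finset K.V // s ∈ K.complex.faces}

/-- The simplices are ordered by inclusion. -/
instance (K : GComplex.{u, v} G) : PartialOrder K.FacePoset :=
  inferInstanceAs (PartialOrder {s : Finset K.V // s ∈ K.complex.faces})

/-- The action on simplices induced by the action on vertices. -/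
instance (K : GComplex.{u, v} G) : MulAction G K.FacePoset where
  smul g s := ⟨s.1.map (MulAction.toPerm g).toEmbedding, K.smul_mem g s.1 s.2⟩
  one_smul s := Subtype.ext (by
    change s.1.map (MulAction.toPerm (1 : G)).toEmbedding = s.1
    ext v
    simp)
  mul_smul g h s := Subtype.ext (by
    change s.1.map (MulAction.toPerm (g * h)).toEmbedding =
      (s.1.map (MulAction.toPerm h).toEmbedding).map (MulAction.toPerm g).toEmbedding
    ext v
    simp [mul_smul])

instance (K : GComplex.{u, v} G) :
    CovariantClass G K.FacePoset HSMul.hSMul LE.le where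
  elim g _ _ h := Finset.map_subset_map.2 h

/-- The order complex `Δ(P)` of a `G`-poset `P`: its vertices are the elements of `P` and its
simplices are the non-empty finite chains of `P`. -/
def orderComplex (G : Type u) [Group G] (P : Type v) [PartialOrder P] [MulAction G P]
    [CovariantClass G P HSMul.hSMul LE.le] : GComplex.{u, v} G where
  V := P
  complex :=
    { faces := {s | s.Nonempty ∧ IsChain (· ≤ ·) (s : Set P)}
      isRelLowerSet_faces := fun _ hs =>
        ⟨hs.1, fun _ hts ht => ⟨ht, hs.2.mono (Finset.coe_subset.2 hts)⟩⟩
      singleton_mem := fun p => ⟨Finset.singleton_nonempty p, by simp⟩ }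
  smul_mem := by
    rintro g s ⟨hne, hs⟩
    refine ⟨hne.map, ?_⟩
    intro a ha b hb _
    simp only [Finset.coe_map, Set.mem_image] at ha hb
    obtain ⟨a, ha, rfl⟩ := ha
    obtain ⟨b, hb, rfl⟩ := hb
    rcases hs.total ha hb with h | h
    · exact Or.inl (smul_mono_right g h)
    · exact Or.inr (smul_mono_right g h)

/-- The barycentric subdivision of `K`: its vertices are the simplices of `K` and its simplices are
the non-empty finite chains of simplices of `K`. -/
def sd (K : GComplex.{u, v} G) : GComplex.{u, v} G := orderComplex G K.FacePoset

/-- The geometric realization of `K`, in barycentric coordinates. -/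
def Realization (K : GComplex.{u, v} G) : Type v :=
  {x : K.V → ℝ // (∀ v, 0 ≤ x v) ∧
    ∃ s ∈ K.complex.faces, (∀ v, v ∉ s → x v = 0) ∧ ∑ v ∈ s, x v = 1}

/-- The subspace topology of `ℝ^V`, which is the usual topology of the polyhedron of a complex with
a finite vertex set `V` (the only case in which it is used). -/
instance (K : GComplex.{u, v} G) : TopologicalSpace K.Realization :=
  inferInstanceAs (TopologicalSpace {x : K.V → ℝ // (∀ v, 0 ≤ x v) ∧
    ∃ s ∈ K.complex.faces, (∀ v, v ∉ s → x v = 0) ∧ ∑ v ∈ s, x v = 1})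

/-- `G` acts by extending the action on the vertices affinely to simplices: the barycentric
coordinate of `g • x` at the vertex `v` is that of `x` at `g⁻¹ • v`. -/
instance (K : GComplex.{u, v} G) : MulAction G K.Realization where
  smul g x := ⟨fun v => x.1 (g⁻¹ • v), fun v => x.2.1 _, by
    obtain ⟨s, hs, h0, h1⟩ := x.2.2
    refine ⟨s.map (MulAction.toPerm g).toEmbedding, K.smul_mem g s hs, fun v hv => h0 _ ?_, ?_⟩
    · intro hmem
      exact hv (Finset.mem_map.2 ⟨g⁻¹ • v, hmem, by simp⟩)
    · simpa [Finset.sum_map] using h1⟩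
  one_smul x := Subtype.ext (funext fun v => by
    change x.1 ((1 : G)⁻¹ • v) = x.1 v
    simp)
  mul_smul g h x := Subtype.ext (funext fun v => by
    change x.1 ((g * h)⁻¹ • v) = x.1 (h⁻¹ • g⁻¹ • v)
    rw [mul_inv_rev, mul_smul])

end GComplex

/-! The two inequalities come from translating between maps of spaces and maps of posets. An
order-preserving `G`-map `h : Q → Q_n G` sends a point of `Δ(Q)` to the join by adding up its
coordinates over each level. Elements of a chain at the same level have the same image, so each
level of positive weight carries one group element (`exists_continuous_of_monotone`). For `Q` the
face poset of `sd^r K`, `Δ(Q)` is `sd^(r+1) K`, which receives a continuous `G`-map from `|K|`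
(`exists_continuous_sd`); no homeomorphism is needed. Hence `ind ≤ xind` for every `r`. Finiteness
of `ind` follows from a level function on `P`. Conversely, let `f : |K| → E_k G` attain the index.
The open stars of the vertices of the join pull back to an open cover of the compact space `|K|`.
Freeness allows an equivariant choice of one star for each point, containing the `f`-image of its
δ-ball. Once adjacent vertices of `sd^r K` are less than δ apart, the stars chosen at them meet, so
their labels in `Q_k G` are comparable; the largest label on each simplex gives the poset map
(`exists_monotone_of_continuous`). -/

namespace QPoset

variable {G : Type u} {n : ℕ}

lemma eq_of_le_of_level_eq {x y : QPoset G n} (h : x ≤ y) (hl : x.level = y.level) : x = y :=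
  h.resolve_right (by simp [hl])

lemma comparable_of_level_imp {x y : QPoset G n} (h : x.level = y.level → x.elt = y.elt) :
    x ≤ y ∨ y ≤ x := by
  rcases lt_trichotomy x.level y.level with hl | hl | hl
  · exact Or.inl (Or.inr hl)
  · exact Or.inl (Or.inl (QPoset.ext (h hl) hl))
  · exact Or.inr (Or.inr hl)

@[simp] lemma smul_elt [Group G] (g : G) (x : QPoset G n) : (g • x).elt = g * x.elt := rfl

@[simp] lemma smul_level [Group G] (g : G) (x : QPoset G n) : (g • x).level = x.level := rfl

lemma smul_le_smul [Group G] (g : G) {x y : QPoset G n} (h : x ≤ y) : g • x ≤ g • y := by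
  rcases h with rfl | h
  · exact le_rfl
  · exact Or.inr h

end QPoset

/-- For a free action, an invariant relation that is total from the left contains the graph of an
equivariant map. -/
lemma exists_equivariant_choice {G X Y : Type*} [Group G] [MulAction G X] [MulAction G Y]
    (hfree : ∀ (g : G) (x : X), g • x = x → g = 1) (R : X → Y → Prop)
    (hR : ∀ x, ∃ y, R x y) (hinv : ∀ (g : G) x y, R x y → R (g • x) (g • y)) :
    ∃ φ : X → Y, (∀ (g : G) x, φ (g • x) = g • φ x) ∧ ∀ x, R x (φ x) := by
  choose ρ hρ using hR
  let rep : X → X := fun x => (Quotient.mk (MulAction.orbitRel G X) x).out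
  have hrep : ∀ x, ∃ g : G, g • rep x = x := fun x =>
    (MulAction.orbitRel G X).symm (Quotient.mk_out (s := MulAction.orbitRel G X) x)
  choose γ hγ using hrep
  have hrep_smul : ∀ (g : G) x, rep (g • x) = rep x := fun g x => by
    have : (Quotient.mk (MulAction.orbitRel G X) (g • x)) =
        Quotient.mk (MulAction.orbitRel G X) x := Quotient.sound ⟨g, rfl⟩
    simp only [rep, this]
  refine ⟨fun x => γ x • ρ (rep x), fun g x => ?_, fun x => ?_⟩
  -- Freeness makes the element carrying the representative to a given point unique, which forces
  -- `γ` to be equivariant.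
  · have h1 : γ (g • x) = g * γ x := by
      have h := hγ (g • x)
      rw [hrep_smul] at h
      have h2 : ((g * γ x)⁻¹ * γ (g • x)) • rep x = rep x := by
        rw [mul_smul, h, mul_inv_rev, mul_smul, inv_smul_smul]
        exact inv_smul_eq_iff.2 (hγ x).symm
      exact (inv_mul_eq_one.1 (hfree _ _ h2)).symm
    simp only [hrep_smul, h1, mul_smul]
  · have := hinv (γ x) _ _ (hρ (rep x))
    rwa [hγ] at this

/-- A finite free `G`-poset maps to some `Q_n G`; the level of a point is the number of points
below it. -/
lemma exists_monotone_equivariant_QPoset (G : Type u) [Group G] (P : Type v) [PartialOrder P]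
    [Finite P] [MulAction G P] [CovariantClass G P HSMul.hSMul LE.le]
    (hfree : ∀ (g : G) (p : P), g • p = p → g = 1) :
    ∃ (n : ℕ) (f : P → QPoset G n), Monotone f ∧ ∀ (g : G) (p : P), f (g • p) = g • f p := by
  obtain ⟨φ, hφ, -⟩ := exists_equivariant_choice (Y := G) hfree (fun _ _ => True)
    (fun _ => ⟨1, trivial⟩) (fun _ _ _ _ => trivial)
  have hlt : ∀ p : P, (Set.Iio p).ncard < Nat.card P + 1 := fun p => by
    have := Set.ncard_le_ncard (Set.subset_univ (Set.Iio p))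
    rw [Set.ncard_univ] at this
    omega
  refine ⟨Nat.card P, fun p => ⟨φ p, ⟨(Set.Iio p).ncard, hlt p⟩⟩, fun p q hpq => ?_,
    fun g p => QPoset.ext (hφ g p) (Fin.ext ?_)⟩
  · rcases hpq.eq_or_lt with rfl | h
    · exact le_rfl
    · refine Or.inr (Fin.mk_lt_mk.2 (Set.ncard_lt_ncard ?_))
      refine ⟨fun r hr => lt_trans hr h, fun hsub => ?_⟩
      exact lt_irrefl p (hsub h)
  · have him : Set.Iio (g • p) = (g • ·) '' Set.Iio p := by
      ext r
      simp only [Set.mem_Iio, Set.mem_image]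
      constructor
      · intro hr
        refine ⟨g⁻¹ • r, lt_of_le_of_ne ?_ ?_, smul_inv_smul g r⟩
        · simpa using smul_mono_right g⁻¹ hr.le
        · rintro rfl
          simp at hr
      · rintro ⟨q, hq, rfl⟩
        exact lt_of_le_of_ne (smul_mono_right g hq.le)
          fun h => hq.ne (MulAction.injective g h)
    change (Set.Iio (g • p)).ncard = (Set.Iio p).ncard
    rw [him, Set.ncard_image_of_injective _ (MulAction.injective g)]

/-! ### Open stars of vertices in the join -/

namespace EG

variable {G : Type u} {k : ℕ}

/-- The open star of the vertex `q` of the join. -/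
def star (q : QPoset G k) : Set (EG G k) :=
  {e | ∃ a, Quotient.mk (joinSetoid G k) a = e ∧
    (a.2 : Fin (k + 1) → ℝ) q.level ≠ 0 ∧ a.1 q.level = q.elt}

lemma mk_mem_star {q : QPoset G k} {a : (Fin (k + 1) → G) × stdSimplex ℝ (Fin (k + 1))} :
    (Quotient.mk (joinSetoid G k) a : EG G k) ∈ star q ↔
      (a.2 : Fin (k + 1) → ℝ) q.level ≠ 0 ∧ a.1 q.level = q.elt := by
  refine ⟨?_, fun h => ⟨a, rfl, h⟩⟩
  rintro ⟨b, hb, h1, h2⟩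
  obtain ⟨e1, e2⟩ := Quotient.exact hb
  exact ⟨e1 ▸ h1, (e2 _ h1).symm.trans h2⟩

/-- The preimage before passing to the quotient is cut out by a nonvanishing weight and a fixed
group coordinate; the latter condition is open because `G` is discrete. -/
lemma isOpen_star [TopologicalSpace G] [DiscreteTopology G] (q : QPoset G k) :
    IsOpen (star q) := by
  refine isOpen_coinduced.2 ?_
  have : Quotient.mk (joinSetoid G k) ⁻¹' star q =
      {a | (a.2 : Fin (k + 1) → ℝ) q.level ≠ 0} ∩ {a | a.1 q.level = q.elt} := by
    ext a
    exact mk_mem_star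
  refine this ▸ IsOpen.inter ?_ ?_
  · exact isOpen_ne.preimage ((continuous_apply q.level).comp
      (continuous_subtype_val.comp continuous_snd))
  · have hc : Continuous fun a : (Fin (k + 1) → G) × stdSimplex ℝ (Fin (k + 1)) => a.1 q.level :=
      (continuous_apply q.level).comp continuous_fst
    exact (isOpen_discrete ({q.elt} : Set G)).preimage hc

lemma exists_mem_star (e : EG G k) : ∃ q, e ∈ star q := by
  induction e using Quotient.inductionOn with
  | h a =>
    have : ∃ i, (a.2 : Fin (k + 1) → ℝ) i ≠ 0 := by
      by_contra! h
      have h1 : ∑ i, (a.2 : Fin (k + 1) → ℝ) i = 1 := a.2.2.2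
      simp [h] at h1
    obtain ⟨i, hi⟩ := this
    exact ⟨⟨a.1 i, i⟩, mk_mem_star.2 ⟨hi, rfl⟩⟩

lemma smul_mem_star [Group G] (g : G) {e : EG G k} {q : QPoset G k} (h : e ∈ star q) :
    g • e ∈ star (g • q) := by
  induction e using Quotient.inductionOn with
  | h a =>
    obtain ⟨h1, h2⟩ := mk_mem_star.1 h
    exact mk_mem_star.2 ⟨h1, congrArg (g * ·) h2⟩

/-- A point of the join has only one group element at each level of positive weight, so two distinct
vertices at the same level have disjoint stars. -/
lemma comparable_of_mem_star {e : EG G k} {q q' : QPoset G k} (h : e ∈ star q)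
    (h' : e ∈ star q') : q ≤ q' ∨ q' ≤ q := by
  induction e using Quotient.inductionOn with
  | h a =>
    refine QPoset.comparable_of_level_imp fun hl => ?_
    rw [← (mk_mem_star.1 h).2, ← (mk_mem_star.1 h').2, hl]

end EG

/-! ### Barycentric coordinates of realizations -/

namespace GComplex

variable {G : Type u} [Group G]

instance (K : GComplex.{u, v} G) [Finite K.V] : Finite K.FacePoset :=
  inferInstanceAs (Finite {s : Finset K.V // s ∈ K.complex.faces})

instance (K : GComplex.{u, v} G) [Finite K.V] : Finite K.sd.V :=
  inferInstanceAs (Finite K.FacePoset)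

namespace Realization

variable {K : GComplex.{u, v} G}

lemma smul_apply (g : G) (x : K.Realization) (v : K.V) : (g • x).1 v = x.1 (g⁻¹ • v) := rfl

lemma smul_apply_smul (g : G) (x : K.Realization) (v : K.V) : (g • x).1 (g • v) = x.1 v := by
  rw [smul_apply, inv_smul_smul]

lemma sum_eq_one [Fintype K.V] (x : K.Realization) : ∑ v, x.1 v = 1 := by
  obtain ⟨s, -, h0, h1⟩ := x.2.2
  exact (Finset.sum_subset (Finset.subset_univ s) fun v _ hv => h0 v hv).symm.trans h1

lemma exists_face (x : K.Realization) : ∃ s ∈ K.complex.faces, ∀ v, x.1 v ≠ 0 → v ∈ s := by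
  obtain ⟨s, hs, h0, -⟩ := x.2.2
  exact ⟨s, hs, fun v hv => by_contra fun h => hv (h0 v h)⟩

lemma exists_ne_zero (x : K.Realization) : ∃ v, x.1 v ≠ 0 := by
  obtain ⟨s, -, -, h1⟩ := x.2.2
  by_contra! h
  simp [h] at h1

/-- A point is determined by non-negative coordinates of sum `1` that are supported on a simplex. -/
def mk [Fintype K.V] (x : K.V → ℝ) (h0 : ∀ v, 0 ≤ x v) (h1 : ∑ v, x v = 1)
    (hx : ∃ s ∈ K.complex.faces, ∀ v, x v ≠ 0 → v ∈ s) : K.Realization :=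
  ⟨x, h0, by
    obtain ⟨s, hs, h⟩ := hx
    have h' : ∀ v, v ∉ s → x v = 0 := fun v hv => by_contra fun hne => hv (h v hne)
    exact ⟨s, hs, h', h1 ▸ Finset.sum_subset (Finset.subset_univ s) fun v _ hv => h' v hv⟩⟩

lemma continuous_apply (v : K.V) : Continuous fun x : K.Realization => x.1 v :=
  (_root_.continuous_apply v).comp continuous_subtype_val

end Realization

/-! ### From order-preserving maps to continuous maps -/

section RealizationToJoin

/-- An order-preserving map to `Q_n G` takes equal values at the elements of a chain that have the
same level. -/
lemma exists_label {Q : Type v} [PartialOrder Q] {n : ℕ} {h : Q → QPoset G n} (hmono : Monotone h) {s : Finset Q}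
    (hs : IsChain (· ≤ ·) (s : Set Q)) :
    ∃ l : Fin (n + 1) → G, ∀ q ∈ s, l (h q).level = (h q).elt := by
  classical
  -- The value 1 at levels not attained on `s` is arbitrary: the join ignores labels of weight zero.
  refine ⟨fun i => if hi : ∃ q ∈ s, (h q).level = i then (h hi.choose).elt else 1,
    fun q hq => ?_⟩
  have hi : ∃ q' ∈ s, (h q').level = (h q).level := ⟨q, hq, rfl⟩
  obtain ⟨h1, h2⟩ := hi.choose_spec
  simp only [dif_pos hi]
  rcases hs.total h1 hq with hle | hle
  · exact congrArg QPoset.elt (QPoset.eq_of_le_of_level_eq (hmono hle) h2)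
  · exact congrArg QPoset.elt (QPoset.eq_of_le_of_level_eq (hmono hle) h2.symm).symm

variable {Q : Type v} [PartialOrder Q] [Fintype Q] [MulAction G Q]
  [CovariantClass G Q HSMul.hSMul LE.le] {n : ℕ}

open Classical in
/-- The barycentric coordinates in the join of the image of a point of `Δ(Q)` under a map
`Q → Q_n G`. -/
noncomputable def levelWeights (h : Q → QPoset G n) (x : (orderComplex G Q).Realization) :
    stdSimplex ℝ (Fin (n + 1)) :=
  ⟨fun i => ∑ q : Q, if (h q).level = i then x.1 q else 0,
    fun i => Finset.sum_nonneg fun q _ => by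
      split_ifs
      · exact x.2.1 q
      · exact le_rfl, by
    rw [Finset.sum_comm]
    simp only [Finset.sum_ite_eq, Finset.mem_univ, if_true]
    exact @Realization.sum_eq_one G _ (orderComplex G Q) ‹Fintype Q› x⟩

lemma exists_of_levelWeights_ne_zero {h : Q → QPoset G n} {x : (orderComplex G Q).Realization}
    {i : Fin (n + 1)} (hi : (levelWeights h x : Fin (n + 1) → ℝ) i ≠ 0) :
    ∃ q : Q, x.1 q ≠ 0 ∧ (h q).level = i := by
  obtain ⟨q, -, hq⟩ := Finset.exists_ne_zero_of_sum_ne_zero hi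
  by_cases hl : (h q).level = i
  · exact ⟨q, by simpa [hl] using hq, hl⟩
  · simp [hl] at hq

lemma continuous_levelWeights (h : Q → QPoset G n) : Continuous (levelWeights h) := by
  refine Continuous.subtype_mk (continuous_pi fun i => continuous_finsetSum _ fun q _ => ?_) _
  split_ifs
  · exact Realization.continuous_apply (K := orderComplex G Q) q
  · exact continuous_const

lemma levelWeights_smul {h : Q → QPoset G n} (heq : ∀ (g : G) q, h (g • q) = g • h q) (g : G)
    (x : (orderComplex G Q).Realization) : levelWeights h (g • x) = levelWeights h x := by
  refine Subtype.ext (funext fun i => ?_)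
  refine (Fintype.sum_equiv (MulAction.toPerm g) _ _ fun q => ?_).symm
  have h1 : (g • x).1 (g • q) = x.1 q :=
    Realization.smul_apply_smul (K := orderComplex G Q) g x q
  simp only [MulAction.toPerm_apply, heq, QPoset.smul_level, h1]

lemma mk_levelWeights_eq {h : Q → QPoset G n} {x : (orderComplex G Q).Realization}
    {l l' : Fin (n + 1) → G} (hl : ∀ q : Q, x.1 q ≠ 0 → l (h q).level = (h q).elt)
    (hl' : ∀ q : Q, x.1 q ≠ 0 → l' (h q).level = (h q).elt) :
    (Quotient.mk (joinSetoid G n) (l, levelWeights h x)) =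
      Quotient.mk (joinSetoid G n) (l', levelWeights h x) := by
  refine Quotient.sound ⟨rfl, fun i hi => ?_⟩
  obtain ⟨q, hq, rfl⟩ := exists_of_levelWeights_ne_zero hi
  exact (hl q hq).trans (hl' q hq).symm

/-- An order-preserving `G`-map `Q → Q_n G` induces a continuous `G`-map `Δ(Q) → E_n G`. -/
lemma exists_continuous_of_monotone [TopologicalSpace G] {h : Q → QPoset G n} (hmono : Monotone h)
    (heq : ∀ (g : G) q, h (g • q) = g • h q) :
    ∃ f : (orderComplex G Q).Realization → EG G n,
      Continuous f ∧ ∀ (g : G) x, f (g • x) = g • f x := by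
  classical
  have hlab : ∀ s : (orderComplex G Q).FacePoset,
      ∃ l : Fin (n + 1) → G, ∀ q : Q, q ∈ s.1 → l (h q).level = (h q).elt :=
    fun s => exists_label hmono s.2.2
  choose l hl using hlab
  have hface : ∀ x : (orderComplex G Q).Realization,
      ∃ s : (orderComplex G Q).FacePoset, ∀ q : Q, x.1 q ≠ 0 → q ∈ s.1 := fun x => by
    obtain ⟨s, hs, hx⟩ := x.exists_face
    exact ⟨⟨s, hs⟩, hx⟩
  choose σ hσ using hface
  let F : (orderComplex G Q).Realization → EG G n :=
    fun x => Quotient.mk (joinSetoid G n) (l (σ x), levelWeights h x)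
  have hF : ∀ x (l' : Fin (n + 1) → G), (∀ q : Q, x.1 q ≠ 0 → l' (h q).level = (h q).elt) →
      F x = Quotient.mk (joinSetoid G n) (l', levelWeights h x) := fun x l' hl' =>
    mk_levelWeights_eq (fun q hq => hl _ q (hσ x q hq)) hl'
  refine ⟨F, ?_, fun g x => ?_⟩
  -- The choice `σ` need not be continuous. On each member of this finite closed cover, however, `F`
  -- agrees with the map given by one constant labelling.
  · let C : (orderComplex G Q).FacePoset → Set (orderComplex G Q).Realization :=
      fun s => {x | ∀ q : Q, q ∉ s.1 → x.1 q = 0}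
    have : Finite (orderComplex G Q).V := inferInstanceAs (Finite Q)
    refine (locallyFinite_of_finite C).continuous ?_ (fun s => ?_) (fun s => ?_)
    · refine Set.eq_univ_of_forall fun x => Set.mem_iUnion.2 ⟨σ x, fun q hq => ?_⟩
      exact by_contra fun hne => hq (hσ x q hne)
    · have : C s = ⋂ q : Q, ⋂ _ : q ∉ s.1, {x | x.1 q = 0} := by
        ext x
        simp [C]
      rw [this]
      exact isClosed_iInter fun q => isClosed_iInter fun _ => isClosed_eq
        (Realization.continuous_apply (K := orderComplex G Q) q) continuous_const
    · have hc : Continuous fun x : (orderComplex G Q).Realization =>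
          (Quotient.mk (joinSetoid G n) (l s, levelWeights h x) : EG G n) :=
        continuous_quotient_mk'.comp (continuous_const.prodMk (continuous_levelWeights h))
      refine hc.continuousOn.congr fun x hx => hF x _ fun q hq => hl s q ?_
      exact by_contra fun hn => hq (hx q hn)
  · rw [hF (g • x) (fun i => g * l (σ x) i), levelWeights_smul heq]
    · rfl
    · intro q hq
      have h1 := hl (σ x) (g⁻¹ • q) (hσ x _ hq)
      rw [heq, QPoset.smul_level, QPoset.smul_elt] at h1
      rw [h1, mul_inv_cancel_left]

end RealizationToJoin

/-! ### The map to the barycentric subdivision -/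

section Subdivision

open Classical in
/-- A function of the coordinates `x` that is positive precisely if `x` is positive on `s` and
every value on `s` is larger than every value off `s`. -/
noncomputable def flagWeight {V : Type*} [Fintype V] (s : Finset V) (x : V → ℝ) : ℝ :=
  ∏ v ∈ s, max (x v) 0 * ∏ w, if w ∈ s then 1 else max (x v - x w) 0

variable {V : Type*} [Fintype V]

lemma flagWeight_nonneg (s : Finset V) (x : V → ℝ) : 0 ≤ flagWeight s x := by
  refine Finset.prod_nonneg fun v _ => mul_nonneg (le_max_right _ _)
    (Finset.prod_nonneg fun w _ => ?_)
  split_ifs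
  · exact zero_le_one
  · exact le_max_right _ _

lemma continuous_flagWeight (s : Finset V) : Continuous (flagWeight s) := by
  refine continuous_finsetProd _ fun v _ => Continuous.mul (by fun_prop)
    (continuous_finsetProd _ fun w _ => ?_)
  split_ifs <;> fun_prop

lemma flagWeight_ne_zero_iff {s : Finset V} {x : V → ℝ} :
    flagWeight s x ≠ 0 ↔ ∀ v ∈ s, 0 < x v ∧ ∀ w, w ∉ s → x w < x v := by
  have hmax : ∀ a : ℝ, max a 0 ≠ 0 ↔ 0 < a := fun a => by
    rcases lt_or_ge 0 a with h | h
    · simp [h.le, h, h.ne']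
    · simp [h]
  simp only [flagWeight, Finset.prod_ne_zero_iff, mul_ne_zero_iff, hmax, Finset.mem_univ,
    true_implies]
  refine forall₂_congr fun v _ => and_congr_right fun _ => forall_congr' fun w => ?_
  by_cases hw : w ∈ s
  · simp [hw]
  · rw [if_neg hw, hmax, sub_pos]
    exact ⟨fun h _ => h, fun h => h hw⟩

lemma flagWeight_map (s : Finset V) (x y : V → ℝ) (e : Equiv.Perm V) (h : ∀ v, y (e v) = x v) :
    flagWeight (s.map e.toEmbedding) y = flagWeight s x := by
  simp only [flagWeight, Finset.prod_map, Equiv.coe_toEmbedding, h]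
  refine Finset.prod_congr rfl fun v _ => congrArg _ ?_
  refine (Fintype.prod_equiv e _ _ fun w => ?_).symm
  have hmem : e w ∈ s.map e.toEmbedding ↔ w ∈ s := Finset.mem_map' e.toEmbedding
  by_cases hw : w ∈ s
  · rw [if_pos hw, if_pos (hmem.2 hw)]
  · rw [if_neg hw, if_neg (mt hmem.1 hw), h]

/-- There is a continuous `G`-map from `|K|` to the realization of the barycentric subdivision. -/
lemma exists_continuous_sd (K : GComplex.{u, v} G) [Finite K.V] :
    ∃ f : K.Realization → K.sd.Realization,
      Continuous f ∧ ∀ (g : G) x, f (g • x) = g • f x := by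
  classical
  have := Fintype.ofFinite K.V
  have := Fintype.ofFinite K.FacePoset
  let _ : Fintype K.sd.V := inferInstanceAs (Fintype K.FacePoset)
  let W : K.Realization → ℝ := fun x => ∑ s : K.FacePoset, flagWeight s.1 x.1
  have hW : ∀ x, 0 < W x := fun x => by
    -- The support of `x` always has positive flag weight, so normalizing by `W` is possible.
    let t : Finset K.V := Finset.univ.filter fun v => x.1 v ≠ 0
    have ht : t ∈ K.complex.faces := by
      obtain ⟨s, hs, hx⟩ := x.exists_face
      obtain ⟨v, hv⟩ := x.exists_ne_zero
      exact (K.complex.isRelLowerSet_faces hs).2 (fun w hw => hx w (by simpa [t] using hw))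
        ⟨v, by simpa [t] using hv⟩
    refine Finset.sum_pos' (fun s _ => flagWeight_nonneg _ _)
      ⟨⟨t, ht⟩, Finset.mem_univ _, (flagWeight_nonneg _ _).lt_of_ne' ?_⟩
    refine flagWeight_ne_zero_iff.2 fun v hv => ?_
    have hv' : 0 < x.1 v := (x.2.1 v).lt_of_ne' (by simpa [t] using hv)
    refine ⟨hv', fun w hw => ?_⟩
    have : x.1 w = 0 := by simpa [t] using hw
    rwa [this]
  have hchain : ∀ x : K.Realization, IsChain (· ≤ ·)
      ((Finset.univ.filter fun s : K.FacePoset => flagWeight s.1 x.1 ≠ 0 : Finset K.FacePoset) :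
        Set K.FacePoset) := by
    intro x s hs t ht _
    replace hs := flagWeight_ne_zero_iff.1 (Finset.mem_filter.1 hs).2
    replace ht := flagWeight_ne_zero_iff.1 (Finset.mem_filter.1 ht).2
    -- For incomparable `s` and `t`, a vertex of `s \ t` and one of `t \ s` would each have the
    -- strictly larger coordinate.
    by_contra! hcon
    obtain ⟨v, hv, hv'⟩ := Finset.not_subset.1 hcon.1
    obtain ⟨w, hw, hw'⟩ := Finset.not_subset.1 hcon.2
    exact lt_asymm ((hs v hv).2 w hw') ((ht w hw).2 v hv')
  let F : K.Realization → K.sd.Realization := fun x =>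
    Realization.mk (K := K.sd) (fun s : K.FacePoset => flagWeight s.1 x.1 / W x)
      (fun s => div_nonneg (flagWeight_nonneg _ _) (hW x).le)
      ((Finset.sum_div _ _ _).symm.trans (div_self (hW x).ne'))
      ⟨Finset.univ.filter fun s : K.FacePoset => flagWeight s.1 x.1 ≠ 0, ⟨by
        obtain ⟨s, -, hs⟩ := Finset.exists_ne_zero_of_sum_ne_zero (hW x).ne'
        exact ⟨s, Finset.mem_filter.2 ⟨Finset.mem_univ _, hs⟩⟩, hchain x⟩,
        fun s hs => Finset.mem_filter.2 ⟨Finset.mem_univ s, fun h0 => hs (by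
          rw [h0, zero_div])⟩⟩
  have hc : ∀ s : K.FacePoset, Continuous fun x : K.Realization => flagWeight s.1 x.1 :=
    fun s => (continuous_flagWeight s.1).comp continuous_subtype_val
  have hsmul : ∀ (g : G) (x : K.Realization) (s : K.FacePoset),
      flagWeight (g • s).1 (g • x).1 = flagWeight s.1 x.1 := fun g x s =>
    flagWeight_map s.1 x.1 (g • x).1 (MulAction.toPerm g)
      fun v => Realization.smul_apply_smul g x v
  refine ⟨F, ?_, fun g x => Subtype.ext (funext fun s => ?_)⟩
  · refine Continuous.subtype_mk (continuous_pi fun s => ?_) _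
    exact (hc s).div (continuous_finsetSum _ fun s _ => hc s) fun x => (hW x).ne'
  · have hWg : W (g • x) = W x :=
      (Fintype.sum_equiv (MulAction.toPerm g) _ _ fun s => (hsmul g x s).symm).symm
    have hs : ∀ t : K.FacePoset, flagWeight t.1 (g • x).1 = flagWeight (g⁻¹ • t).1 x.1 :=
      fun t => by rw [← hsmul g x, smul_inv_smul]
    exact congrArg₂ (· / ·) (hs s) hWg

lemma exists_continuous_sd_iterate (K : GComplex.{u, v} G) [Finite K.V] (r : ℕ) :
    Finite (GComplex.sd^[r] K).V ∧ ∃ f : K.Realization → (GComplex.sd^[r] K).Realization,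
      Continuous f ∧ ∀ (g : G) x, f (g • x) = g • f x := by
  induction r with
  | zero => exact ⟨‹_›, id, continuous_id, fun _ _ => rfl⟩
  | succ r ih =>
    obtain ⟨hfin, f, hf, hfg⟩ := ih
    rw [Function.iterate_succ_apply']
    obtain ⟨f', hf', hfg'⟩ := exists_continuous_sd (GComplex.sd^[r] K)
    exact ⟨inferInstance, f' ∘ f, hf'.comp hf, fun g x => by simp [hfg, hfg']⟩

end Subdivision

end GComplex

namespace GComplex

variable {G : Type u} [Group G]

/-! ### Iterated barycentres -/

section Barycentre

variable {E A : Type*} [SeminormedAddCommGroup E] [NormedSpace ℝ E]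

/-- The barycentre of the points `j v`, `v ∈ s`. -/
noncomputable def barycentre (j : A → E) (s : Finset A) : E :=
  (s.card : ℝ)⁻¹ • ∑ v ∈ s, j v

/-- The difference is the average of `j v - j w` over `s × t`. Since `s ⊆ t`, one term in each row
vanishes, which gains the factor `1 - 1/|t|`. -/
lemma norm_barycentre_sub_le {j : A → E} {s t : Finset A} {D : ℝ} {N : ℕ} (hs : s.Nonempty)
    (hst : s ⊆ t) (hN : t.card ≤ N) (hD : 0 ≤ D) (hj : ∀ v ∈ t, ∀ w ∈ t, ‖j v - j w‖ ≤ D) :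
    ‖barycentre j s - barycentre j t‖ ≤ (1 - (N : ℝ)⁻¹) * D := by
  classical
  have hs0 : (0 : ℝ) < s.card := by exact_mod_cast hs.card_pos
  have ht1 : 1 ≤ t.card := (hs.mono hst).card_pos
  have ht0 : (0 : ℝ) < t.card := by exact_mod_cast ht1
  have key : barycentre j s - barycentre j t =
      ((s.card : ℝ)⁻¹ * (t.card : ℝ)⁻¹) • ∑ v ∈ s, ∑ w ∈ t, (j v - j w) := by
    simp only [Finset.sum_sub_distrib, Finset.sum_const, ← Finset.smul_sum, smul_sub,
      ← Nat.cast_smul_eq_nsmul ℝ, smul_smul, barycentre]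
    congr 2 <;> field_simp
  have hrow : ∀ v ∈ s, ‖∑ w ∈ t, (j v - j w)‖ ≤ (t.card - 1) * D := fun v hv => by
    rw [← Finset.sum_erase t (a := v) (sub_self (j v))]
    refine (norm_sum_le_of_le (t.erase v) fun w hw =>
      hj v (hst hv) w (Finset.mem_of_mem_erase hw)).trans (le_of_eq ?_)
    rw [Finset.sum_const, Finset.card_erase_of_mem (hst hv), nsmul_eq_mul, Nat.cast_sub ht1,
      Nat.cast_one]
  have hbound : ‖∑ v ∈ s, ∑ w ∈ t, (j v - j w)‖ ≤ s.card * ((t.card - 1) * D) :=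
    (norm_sum_le_of_le s hrow).trans (by rw [Finset.sum_const, nsmul_eq_mul])
  rw [key, norm_smul, Real.norm_of_nonneg (by positivity)]
  calc (s.card : ℝ)⁻¹ * (t.card : ℝ)⁻¹ * ‖∑ v ∈ s, ∑ w ∈ t, (j v - j w)‖
      ≤ (s.card : ℝ)⁻¹ * (t.card : ℝ)⁻¹ * (s.card * ((t.card - 1) * D)) := by gcongr
    _ = (1 - (t.card : ℝ)⁻¹) * D := by field_simp
    _ ≤ (1 - (N : ℝ)⁻¹) * D := by gcongr

end Barycentre

/-- A vertex map from `L` to the realization of `K` that is equivariant, maps every simplex of `L`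
into a simplex of `K`, and moves adjacent vertices at most `D` apart. The simplices of `L` have at
most `N` vertices. -/
structure IsFineVertexMap (K L : GComplex.{u, v} G) [Fintype K.V] (N : ℕ) (D : ℝ)
    (j : L.V → K.V → ℝ) : Prop where
  equivariant : ∀ (g : G) v w, j (g • v) (g • w) = j v w
  nonneg : ∀ v w, 0 ≤ j v w
  sum_eq_one : ∀ v, ∑ w, j v w = 1
  carrier : ∀ s ∈ L.complex.faces, ∃ t ∈ K.complex.faces, ∀ v ∈ s, ∀ w, j v w ≠ 0 → w ∈ t
  mesh : ∀ s ∈ L.complex.faces, ∀ v ∈ s, ∀ w ∈ s, ‖j v - j w‖ ≤ D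
  card_le : ∀ s ∈ L.complex.faces, s.card ≤ N

/-- The largest simplex of a chain provides a carrier for all its barycentres. The bound `N`
survives because cardinality is injective on a chain of simplices, so the contraction ratio is the
same at every subdivision. -/
lemma IsFineVertexMap.sd {K L : GComplex.{u, v} G} [Fintype K.V] {N : ℕ} {D : ℝ}
    {j : L.V → K.V → ℝ} (hD : 0 ≤ D) (hj : IsFineVertexMap K L N D j) :
    IsFineVertexMap K L.sd N ((1 - (N : ℝ)⁻¹) * D)
      (fun s : L.FacePoset => barycentre j s.1) := by
  have hne : ∀ s : L.FacePoset, s.1.Nonempty := fun s => (L.complex.isRelLowerSet_faces s.2).1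
  have happ : ∀ (s : L.FacePoset) w,
      barycentre j s.1 w = (s.1.card : ℝ)⁻¹ * ∑ v ∈ s.1, j v w := fun s w => by
    simp [barycentre]
  have hequiv : ∀ (g : G) (s : L.FacePoset) w,
      barycentre j (g • s).1 (g • w) = barycentre j s.1 w := fun g s w => by
    rw [happ, happ]
    have hs : (g • s).1 = s.1.map (MulAction.toPerm g).toEmbedding := rfl
    simp [hs, hj.equivariant]
  have hnonneg : ∀ (s : L.FacePoset) w, 0 ≤ barycentre j s.1 w := fun s w => by
    rw [happ]
    exact mul_nonneg (by positivity) (Finset.sum_nonneg fun v _ => hj.nonneg v w)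
  have hsum : ∀ s : L.FacePoset, ∑ w, barycentre j s.1 w = 1 := fun s => by
    simp only [happ]
    rw [← Finset.mul_sum, Finset.sum_comm]
    simp only [hj.sum_eq_one, Finset.sum_const, nsmul_eq_mul, mul_one]
    exact inv_mul_cancel₀ (by exact_mod_cast (hne s).card_pos.ne')
  have hcarrier : ∀ c : Finset L.FacePoset, c.Nonempty → IsChain (· ≤ ·) (c : Set L.FacePoset) →
      ∃ t ∈ K.complex.faces, ∀ s ∈ c, ∀ w, barycentre j s.1 w ≠ 0 → w ∈ t := by
    intro c hc hchain
    obtain ⟨m, hm, hmax⟩ : ∃ m ∈ c, ∀ s ∈ c, s ≤ m := by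
      obtain ⟨m, hm⟩ := Finset.exists_maximal hc
      exact ⟨m, hm.1, fun s hs => (hchain.total hs hm.1).elim id (hm.2 hs)⟩
    obtain ⟨t, ht, hjt⟩ := hj.carrier m.1 m.2
    refine ⟨t, ht, fun s hs w hw => ?_⟩
    rw [happ] at hw
    obtain ⟨v, hv, hvw⟩ := Finset.exists_ne_zero_of_sum_ne_zero (right_ne_zero_of_mul hw)
    exact hjt v (hmax s hs hv) w hvw
  have hmesh : ∀ s t : L.FacePoset, s ≤ t ∨ t ≤ s →
      ‖barycentre j s.1 - barycentre j t.1‖ ≤ (1 - (N : ℝ)⁻¹) * D := by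
    rintro s t (h | h)
    · exact norm_barycentre_sub_le (hne s) h (hj.card_le _ t.2) hD (hj.mesh _ t.2)
    · rw [norm_sub_rev]
      exact norm_barycentre_sub_le (hne t) h (hj.card_le _ s.2) hD (hj.mesh _ s.2)
  have hcard : ∀ c : Finset L.FacePoset, IsChain (· ≤ ·) (c : Set L.FacePoset) → c.card ≤ N := by
    intro c hchain
    have hmaps : ∀ s ∈ c, s.1.card ∈ Finset.Icc 1 N :=
      fun s _ => Finset.mem_Icc.2 ⟨(hne s).card_pos, hj.card_le _ s.2⟩
    refine (Finset.card_le_card_of_injOn _ hmaps fun s hs t ht hst => ?_).trans (by simp)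
    rcases hchain.total hs ht with h | h
    · exact Subtype.ext (Finset.eq_of_subset_of_card_le h hst.ge)
    · exact Subtype.ext (Finset.eq_of_subset_of_card_le h hst.le).symm
  exact ⟨hequiv, hnonneg, hsum, fun c hc => hcarrier c hc.1 hc.2,
    fun c hc s hs t ht => hmesh s t (hc.2.total hs ht), fun c hc => hcard c hc.2⟩

open Classical in
lemma isFineVertexMap_single (K : GComplex.{u, v} G) [Fintype K.V] :
    IsFineVertexMap K K (Fintype.card K.V) 1 (fun v => Pi.single v 1) where
  equivariant g v w := by simp [Pi.single_apply]
  nonneg v w := by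
    rw [Pi.single_apply]
    split_ifs <;> norm_num
  sum_eq_one v := by simp
  carrier s hs := ⟨s, hs, fun v hv w hw => by
    rw [Pi.single_apply] at hw
    split_ifs at hw with h
    · exact h ▸ hv
    · exact absurd rfl hw⟩
  mesh s _ v _ w _ := by
    refine (pi_norm_le_iff_of_nonneg zero_le_one).2 fun a => ?_
    simp only [Pi.sub_apply, Pi.single_apply]
    split_ifs <;> norm_num
  card_le s _ := Finset.card_le_univ s

lemma exists_isFineVertexMap_iterate (K : GComplex.{u, v} G) [Fintype K.V] (r : ℕ) :
    ∃ j, IsFineVertexMap K (GComplex.sd^[r] K) (Fintype.card K.V)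
      ((1 - (Fintype.card K.V : ℝ)⁻¹) ^ r) j := by
  classical
  induction r with
  | zero => exact ⟨_, by simpa using isFineVertexMap_single K⟩
  | succ r ih =>
    obtain ⟨j, hj⟩ := ih
    rw [Function.iterate_succ_apply', pow_succ']
    exact ⟨_, hj.sd (pow_nonneg (sub_nonneg.2 (Nat.cast_inv_le_one _)) r)⟩

/-! ### From continuous maps to order-preserving maps -/

lemma isCompact_realization (K : GComplex.{u, v} G) [Fintype K.V] :
    IsCompact {x : K.V → ℝ | (∀ v, 0 ≤ x v) ∧
      ∃ s ∈ K.complex.faces, (∀ v, v ∉ s → x v = 0) ∧ ∑ v ∈ s, x v = 1} := by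
  refine (isCompact_Icc (a := (0 : K.V → ℝ)) (b := 1)).of_isClosed_subset ?_ ?_
  · have : {x : K.V → ℝ | (∀ v, 0 ≤ x v) ∧
        ∃ s ∈ K.complex.faces, (∀ v, v ∉ s → x v = 0) ∧ ∑ v ∈ s, x v = 1} =
        (⋂ v, {x | 0 ≤ x v}) ∩ ⋃ s ∈ K.complex.faces,
          (⋂ v, ⋂ _ : v ∉ s, {x | x v = 0}) ∩ {x | ∑ v ∈ s, x v = 1} := by
      ext x
      simp only [Set.mem_ofPred_eq, Set.mem_inter_iff, Set.mem_iInter, Set.mem_iUnion, exists_prop]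
    rw [this]
    refine (isClosed_iInter fun v => isClosed_le continuous_const (continuous_apply v)).inter
      ((Set.toFinite _).isClosed_biUnion fun s _ => ?_)
    exact (isClosed_iInter fun v => isClosed_iInter fun _ =>
      isClosed_eq (continuous_apply v) continuous_const).inter
      (isClosed_eq (by fun_prop) continuous_const)
  · rintro x ⟨h0, s, -, hs, h1⟩
    refine ⟨h0, fun v => ?_⟩
    by_cases hv : v ∈ s
    · change x v ≤ 1
      rw [← h1]
      exact Finset.single_le_sum (fun w _ => h0 w) hv
    · simp [hs v hv]

/-- An equivariant vertex map that sends simplices to chains induces an order-preserving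
equivariant map on the face poset: a simplex goes to the largest value at its vertices. -/
lemma exists_monotone_of_chain {L : GComplex.{u, v} G} {k : ℕ} (ψ : L.V → QPoset G k)
    (hψ : ∀ (g : G) v, ψ (g • v) = g • ψ v)
    (hc : ∀ s ∈ L.complex.faces, ∀ v ∈ s, ∀ w ∈ s, ψ v ≤ ψ w ∨ ψ w ≤ ψ v) :
    ∃ f : L.FacePoset → QPoset G k, Monotone f ∧ ∀ (g : G) s, f (g • s) = g • f s := by
  have hmax : ∀ s : L.FacePoset, ∃ q, IsGreatest (ψ '' (s.1 : Set L.V)) q := fun s => by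
    have hne : (s.1 : Set L.V).Nonempty := (L.complex.isRelLowerSet_faces s.2).1
    obtain ⟨m, hm⟩ := (s.1.finite_toSet.image ψ).exists_maximal (hne.image ψ)
    refine ⟨m, hm.1, ?_⟩
    obtain ⟨v, hv, rfl⟩ := hm.1
    rintro _ ⟨w, hw, rfl⟩
    exact (hc s.1 s.2 w hw v hv).elim id (hm.2 ⟨w, hw, rfl⟩)
  choose f hf using hmax
  refine ⟨f, fun s t hst => (hf t).2 (Set.image_mono hst (hf s).1), fun g s => ?_⟩
  refine (hf (g • s)).unique ⟨?_, ?_⟩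
  · obtain ⟨v, hv, hvs⟩ := (hf s).1
    exact ⟨g • v, Finset.mem_map_of_mem _ hv, by rw [hψ, hvs]⟩
  · rintro _ ⟨w, hw, rfl⟩
    obtain ⟨v, hv, rfl⟩ := Finset.mem_map.1 hw
    change ψ (g • v) ≤ _
    rw [hψ]
    exact QPoset.smul_le_smul g ((hf s).2 ⟨v, hv, rfl⟩)

/-- An element fixing `x` permutes the support of `x`, a finite chain, and hence fixes its greatest
element. -/
lemma smul_realization_free {P : Type v} [PartialOrder P] [MulAction G P]
    [CovariantClass G P HSMul.hSMul LE.le] (hfree : ∀ (g : G) (p : P), g • p = p → g = 1)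
    (g : G) (x : (orderComplex G P).Realization) (hx : g • x = x) : g = 1 := by
  classical
  obtain ⟨s, hs, hxs⟩ := x.exists_face
  have hfix : ∀ h : G, h • x = x → ∀ p : P, x.1 p ≠ 0 → x.1 (h • p : P) ≠ 0 := fun h hh p hp => by
    have := Realization.smul_apply_smul (K := orderComplex G P) h x p
    rw [hh] at this
    exact fun h0 => hp (this.symm.trans h0)
  obtain ⟨m, hm, hmax⟩ : ∃ m : P, x.1 m ≠ 0 ∧ ∀ p : P, x.1 p ≠ 0 → p ≤ m := by
    obtain ⟨v, hv⟩ := x.exists_ne_zero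
    have hfin : {p : P | x.1 p ≠ 0}.Finite := s.finite_toSet.subset fun p hp => hxs p hp
    obtain ⟨m, hm⟩ := hfin.exists_maximal ⟨v, hv⟩
    exact ⟨m, hm.1, fun p hp => (hs.2.total (hxs p hp) (hxs m hm.1)).elim id (hm.2 hp)⟩
  refine hfree g m (le_antisymm (hmax _ (hfix g hx m hm)) ?_)
  have := smul_mono_right g (hmax _ (hfix g⁻¹ (inv_smul_eq_iff.2 hx.symm) m hm))
  rwa [smul_inv_smul] at this

/-- Equivariant simplicial approximation: a continuous `G`-map from a free finite complex to
`E_k G` yields order-preserving `G`-maps to `Q_k G` from the face posets of all sufficiently fine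
subdivisions. -/
lemma exists_monotone_of_continuous [TopologicalSpace G] [DiscreteTopology G]
    (K : GComplex.{u, v} G) [Finite K.V]
    (hfree : ∀ (g : G) (x : K.Realization), g • x = x → g = 1) {k : ℕ}
    (f : K.Realization → EG G k) (hf : Continuous f) (hfg : ∀ (g : G) x, f (g • x) = g • f x) :
    ∃ r₀ : ℕ, ∀ r : ℕ, r₀ ≤ r → ∃ h : (GComplex.sd^[r] K).FacePoset → QPoset G k,
      Monotone h ∧ ∀ (g : G) s, h (g • s) = g • h s := by
  have := Fintype.ofFinite K.V
  obtain ⟨δ, hδ, hball⟩ : ∃ δ > 0, ∀ x : K.Realization, ∃ q : QPoset G k,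
      ∀ z : K.Realization, ‖z.1 - x.1‖ < δ → f z ∈ EG.star q := by
    have hcomp := isCompact_univ_iff.2 (isCompact_iff_compactSpace.1 (isCompact_realization K))
    obtain ⟨δ, hδ, h⟩ := lebesgue_number_lemma_of_metric
      (α := {x : K.V → ℝ // (∀ v, 0 ≤ x v) ∧
        ∃ s ∈ K.complex.faces, (∀ v, v ∉ s → x v = 0) ∧ ∑ v ∈ s, x v = 1})
      (c := fun q : QPoset G k => f ⁻¹' EG.star q) hcomp
      (fun q => (EG.isOpen_star q).preimage hf)
      (fun x _ => Set.mem_iUnion.2 (EG.exists_mem_star (f x)))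
    refine ⟨δ, hδ, fun x => ?_⟩
    obtain ⟨q, hq⟩ := h x trivial
    refine ⟨q, fun z hz => hq ?_⟩
    change dist z.1 x.1 < δ
    rwa [dist_eq_norm]
  obtain ⟨φ, hφ, hφδ⟩ := exists_equivariant_choice hfree
    (fun x q => ∀ z : K.Realization, ‖z.1 - x.1‖ < δ → f z ∈ EG.star q) hball
    (fun g x q hxq z hz => by
      have : ‖(g⁻¹ • z).1 - x.1‖ < δ := by
        -- The action permutes coordinates, so it preserves the sup norm and the same δ serves a
        -- whole orbit.
        refine lt_of_le_of_lt ((pi_norm_le_iff_of_nonneg (norm_nonneg _)).2 fun v => ?_) hz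
        refine le_trans (le_of_eq ?_) (norm_le_pi_norm _ (g • v))
        rw [Pi.sub_apply, Pi.sub_apply, Realization.smul_apply, inv_inv,
          Realization.smul_apply_smul]
      have := EG.smul_mem_star g (hxq _ this)
      rwa [← hfg, smul_inv_smul] at this)
  -- With no vertices the convention `0⁻¹ = 0` makes the ratio 1, so the empty complex is treated
  -- apart.
  have hlt : 1 - (Fintype.card K.V : ℝ)⁻¹ < 1 ∨ IsEmpty K.V := by
    rcases isEmpty_or_nonempty K.V with h | h
    · exact Or.inr h
    · exact Or.inl (sub_lt_self _ (by positivity))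
  obtain ⟨r₀, hr₀⟩ : ∃ r₀ : ℕ, IsEmpty K.V ∨
      ∀ r ≥ r₀, (1 - (Fintype.card K.V : ℝ)⁻¹) ^ r < δ := by
    rcases hlt with h | h
    · have := (tendsto_pow_atTop_nhds_zero_of_lt_one (sub_nonneg.2 (Nat.cast_inv_le_one _)) h).eventually
        (gt_mem_nhds hδ)
      obtain ⟨r₀, h⟩ := Filter.eventually_atTop.1 this
      exact ⟨r₀, Or.inr h⟩
    · exact ⟨0, Or.inl h⟩
  refine ⟨r₀, fun r hr => ?_⟩
  obtain ⟨j, hj⟩ := exists_isFineVertexMap_iterate K r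
  have hcar : ∀ v, ∃ s ∈ K.complex.faces, ∀ w, j v w ≠ 0 → w ∈ s := fun v => by
    obtain ⟨t, ht, h⟩ := hj.carrier _ ((GComplex.sd^[r] K).complex.singleton_mem v)
    exact ⟨t, ht, h v (Finset.mem_singleton_self v)⟩
  let J : (GComplex.sd^[r] K).V → K.Realization := fun v =>
    Realization.mk (j v) (hj.nonneg v) (hj.sum_eq_one v) (hcar v)
  have hJ : ∀ (g : G) v, J (g • v) = g • J v := fun g v => Subtype.ext (funext fun w => by
    rw [Realization.smul_apply]
    change j (g • v) w = j v (g⁻¹ • w)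
    rw [← hj.equivariant g v, smul_inv_smul])
  refine exists_monotone_of_chain (fun v => φ (J v)) (fun g v => by rw [hJ, hφ])
    fun s hs v hv w hw => ?_
  have hsmall : ‖(J v).1 - (J w).1‖ < δ := by
    refine lt_of_le_of_lt (hj.mesh s hs v hv w hw) ?_
    rcases hr₀ with h | h
    · obtain ⟨a, -⟩ := (J v).exists_ne_zero
      exact h.elim a
    · exact h r hr
  -- The common point of the two stars is `f (J v)`, as `J v` lies in the δ-balls about both `J v`
  -- and `J w`.
  exact EG.comparable_of_mem_star (hφδ (J v) (J v) (by simpa using hδ)) (hφδ (J w) (J v) hsmall)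

end GComplex

/-! ### Attaining the mapping index, and the conclusion -/

lemma mappingIndex_le {G : Type u} [Group G] [TopologicalSpace G] {X : Type v}
    [TopologicalSpace X] [MulAction G X] {k : ℕ} {f : X → EG G k} (hf : Continuous f)
    (hfg : ∀ (g : G) x, f (g • x) = g • f x) : mappingIndex G X ≤ k :=
  iInf₂_le k ⟨f, hf, hfg⟩

lemma exists_continuous_of_mappingIndex_ne_top {G : Type u} [Group G] [TopologicalSpace G]
    {X : Type v} [TopologicalSpace X] [MulAction G X] (h : mappingIndex G X ≠ ⊤) :
    ∃ (k : ℕ) (f : X → EG G k), Continuous f ∧ (∀ (g : G) x, f (g • x) = g • f x) ∧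
      mappingIndex G X = k := by
  classical
  have hex : ∃ k : ℕ, ∃ f : X → EG G k, Continuous f ∧ ∀ (g : G) x, f (g • x) = g • f x := by
    by_contra! hcon
    refine h (iInf₂_eq_top.2 fun k hk => ?_)
    obtain ⟨f, hf, hfg⟩ := hk
    obtain ⟨g, x, hgx⟩ := hcon k f hf
    exact absurd (hfg g x) hgx
  obtain ⟨f, hf, hfg⟩ := Nat.find_spec hex
  refine ⟨Nat.find hex, f, hf, hfg, le_antisymm (mappingIndex_le hf hfg) ?_⟩
  exact le_iInf₂ fun k hk => Nat.cast_le.2 (Nat.find_min' hex hk)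

theorem mainTheorem6 (G : Type u) [Group G] [Finite G] [Nontrivial G]
    [TopologicalSpace G] [DiscreteTopology G]
    (P : Type v) [PartialOrder P] [Finite P] [MulAction G P]
    [CovariantClass G P HSMul.hSMul LE.le]
    (hfree : ∀ (g : G) (p : P), g • p = p → g = 1) :
    mappingIndex G (GComplex.orderComplex G P).Realization ≠ ⊤ ∧
    ∃ r₀ : ℕ, ∀ r : ℕ, r₀ ≤ r →
      crossIndex G (GComplex.sd^[r] (GComplex.orderComplex G P)).FacePoset =
        mappingIndex G (GComplex.orderComplex G P).Realization := by
  have := Fintype.ofFinite P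
  have : Finite (GComplex.orderComplex G P).V := ‹Finite P›
  have htop : mappingIndex G (GComplex.orderComplex G P).Realization ≠ ⊤ := by
    obtain ⟨n, h, hmono, heq⟩ := exists_monotone_equivariant_QPoset G P hfree
    obtain ⟨f, hf, hfg⟩ := GComplex.exists_continuous_of_monotone hmono heq
    exact ne_top_of_le_ne_top (ENat.natCast_ne_top n) (mappingIndex_le hf hfg)
  refine ⟨htop, ?_⟩
  obtain ⟨k, f, hf, hfg, hk⟩ := exists_continuous_of_mappingIndex_ne_top htop
  obtain ⟨r₀, hr₀⟩ := GComplex.exists_monotone_of_continuous (GComplex.orderComplex G P)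
    (GComplex.smul_realization_free hfree) f hf hfg
  refine ⟨r₀, fun r hr => le_antisymm ?_ ?_⟩
  · rw [hk]
    exact iInf₂_le k (hr₀ r hr)
  · refine le_iInf₂ fun n hn => ?_
    obtain ⟨h, hmono, heq⟩ := hn
    obtain ⟨hfin, f₁, hf₁, hfg₁⟩ :=
      GComplex.exists_continuous_sd_iterate (GComplex.orderComplex G P) r
    -- One more subdivision is needed because `h` is defined on faces of `sd^r`, which are the
    -- vertices of `sd^(r+1)`.
    obtain ⟨f₂, hf₂, hfg₂⟩ :=
      GComplex.exists_continuous_sd (GComplex.sd^[r] (GComplex.orderComplex G P))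
    have := Fintype.ofFinite (GComplex.sd^[r] (GComplex.orderComplex G P)).FacePoset
    obtain ⟨f₃, hf₃, hfg₃⟩ := GComplex.exists_continuous_of_monotone hmono heq
    exact mappingIndex_le (f := fun x => f₃ (f₂ (f₁ x))) (hf₃.comp (hf₂.comp hf₁))
      fun g x => by rw [hfg₁, hfg₂]; exact hfg₃ g _
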